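/- Let $A\in\mathbb{R}^{d\times d}$ be symmetric positive definite, $B\in\mathbb{R}^{d\times m}$, $\varepsilon>0$ and $S>0$. Consider the Ornstein--Uhlenbeck equation $$d\theta(t)=-\varepsilon A\,\theta(t)\,dt+\frac{\varepsilon}{\sqrt S}\,B\,dW(t),\qquad t\ge 0,$$ where $W$ is a standard $m$-dimensional Brownian motion and the initial value $\theta(0)$ is independent of $W$; a solution is a process with almost surely continuous paths such that almost surely $\theta(t)=\theta(0)-\int_0^t\varepsilon A\theta(s)\,ds+\frac{\varepsilon}{\sqrt S}BW(t)$ for all $t\ge0$. For every Brownian motion $W$ and every random initial value independent of $W$ a solution exists. There is a probability measure $q$ on $\mathbb{R}^d$, depending only on $A,B,\varepsilon,S$, that is stationary: every solution with $\theta(0)\sim q$ satisfies $\theta(t)\sim q$ for all $t\ge0$. It is the only stationary distribution: if some solution has the same law $\nu$ at all times $t\ge 0$, then $\nu=q$. The measure $q$ is Gaussian with mean $0$, and its covariance matrix $\Sigma$ satisfies $$\Sigma A+A\Sigma=\frac{\varepsilon}{S}\,BB^\top .$$ -/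

import Mathlib

open MeasureTheory ProbabilityTheory
open scoped NNReal Matrix

/-- `W` is a standard `m`-dimensional Brownian motion: its coordinates are independent standard
real Brownian motions (started at `0`, with almost surely continuous paths). -/
structure IsStandardBrownianMotion {m : ℕ} {Ω : Type*} [MeasurableSpace Ω] (P : Measure Ω)
    (W : ℝ≥0 → Ω → EuclideanSpace ℝ (Fin m)) : Prop where
  isBrownianReal : ∀ j, IsBrownianReal (fun t ω ↦ W t ω j) P
  iIndepFun : iIndepFun (fun j ω (t : ℝ≥0) ↦ W t ω j) P

/-- `θ` is a solution of `dθ(t) = -ε A θ(t) dt + (ε / √S) B dW(t)` on the probability space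
`(Ω, P)`, driven by the standard Brownian motion `W`, with initial value independent of `W`.
Since the diffusion coefficient is constant, the stochastic integral `∫₀ᵗ B dW` is `B W(t)`,
and the equation holds pathwise in its integrated form. -/
structure IsOUProcess {d m : ℕ} (A : Matrix (Fin d) (Fin d) ℝ) (B : Matrix (Fin d) (Fin m) ℝ)
    (ε S : ℝ) {Ω : Type*} [MeasurableSpace Ω] (P : Measure Ω)
    (W : ℝ≥0 → Ω → EuclideanSpace ℝ (Fin m)) (θ : ℝ≥0 → Ω → EuclideanSpace ℝ (Fin d)) :
    Prop where
  brownian : IsStandardBrownianMotion P W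
  aemeasurable : ∀ t, AEMeasurable (θ t) P
  indep_initial : IndepFun (θ 0) (fun ω (t : ℝ≥0) ↦ W t ω) P
  continuous_paths : ∀ᵐ ω ∂P, Continuous fun t ↦ θ t ω
  equation : ∀ᵐ ω ∂P, ∀ t : ℝ≥0,
    θ t ω = θ 0 ω
      - (∫ s in (0 : ℝ)..(t : ℝ), ε • WithLp.toLp 2 (A *ᵥ (θ s.toNNReal ω).ofLp))
      + (ε / √S) • WithLp.toLp 2 (B *ᵥ (W t ω).ofLp)

/-- The covariance matrix of a probability measure on `ℝᵈ`. -/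
noncomputable def covarianceMatrix {d : ℕ} (q : Measure (EuclideanSpace ℝ (Fin d))) :
    Matrix (Fin d) (Fin d) ℝ :=
  Matrix.of fun i j ↦ cov[fun x ↦ x i, fun x ↦ x j; q]

/-! Put `M = ε A` and `N = (ε / √S) B`. Variation of constants writes `⟪x, θ t⟫` as `⟪exp (-t M) x,
θ 0⟫` plus the Wiener integral of `N* exp (-(t - s) M) x`. This integrand is deterministic and
smooth, so no Itô calculus is needed: along each continuous path its Riemann sums converge by
integration by parts (`tendsto_sum_inner_increment`). The sums are independent of `θ 0` and centred
Gaussian, with variances that are Riemann sums of `‖N* exp (-(t - s) M) x‖²`.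

If `X A + A X = (ε / S) B Bᵀ`, that function of `s` is the derivative of the quadratic form of `X`
along `exp (-(t - s) M) x`, so the limiting variance is a difference of boundary values. Dominated
convergence gives the transition law (`charFun_ornsteinUhlenbeck`). The Gaussian with covariance `X`
is visibly invariant under it; letting `t → ∞`, where `exp (-t M) x → 0`, forces every stationary
law to be this Gaussian. -/

open Filter Topology

/-! ### Pathwise Riemann–Stieltjes sums against a continuous integrator -/

section RiemannStieltjes

variable {V : Type*} [NormedAddCommGroup V] [InnerProductSpace ℝ V]

theorem norm_inner_increment_sub_le {φ φ' w : ℝ → V} (hφ : ∀ s, HasDerivAt φ (φ' s) s)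
    (hφ' : Continuous φ') (hw : Continuous w) {a b C δ : ℝ} (hab : a ≤ b)
    (hC : ∀ s ∈ Set.Icc a b, ‖φ' s‖ ≤ C) (hδ : ∀ s ∈ Set.Icc a b, ‖w s - w b‖ ≤ δ) :
    ‖inner ℝ (φ a) (w b - w a) -
      (inner ℝ (φ b) (w b) - inner ℝ (φ a) (w a) - ∫ s in a..b, inner ℝ (φ' s) (w s))‖
        ≤ C * δ * (b - a) := by
  have h1 : ∫ s in a..b, inner ℝ (φ' s) (w b) = inner ℝ (φ b) (w b) - inner ℝ (φ a) (w b) :=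
    intervalIntegral.integral_eq_sub_of_hasDerivAt (f := fun s ↦ inner ℝ (φ s) (w b))
      (fun s _ ↦ by simpa using (hφ s).inner ℝ (hasDerivAt_const s (w b)))
      (Continuous.intervalIntegrable (by fun_prop) _ _)
  have h2 : inner ℝ (φ a) (w b - w a) -
      (inner ℝ (φ b) (w b) - inner ℝ (φ a) (w a) - ∫ s in a..b, inner ℝ (φ' s) (w s))
      = ∫ s in a..b, inner ℝ (φ' s) (w s - w b) := by
    simp_rw [inner_sub_right]
    rw [intervalIntegral.integral_sub (Continuous.intervalIntegrable (by fun_prop) _ _)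
      (Continuous.intervalIntegrable (by fun_prop) _ _), h1]
    ring
  rw [h2, ← abs_of_nonneg (sub_nonneg.2 hab)]
  refine intervalIntegral.norm_integral_le_of_norm_le_const fun s hs ↦ ?_
  rw [Set.uIoc_of_le hab] at hs
  have hs' := Set.Ioc_subset_Icc_self hs
  exact (norm_inner_le_norm _ _).trans (mul_le_mul (hC s hs') (hδ s hs') (norm_nonneg _)
    ((norm_nonneg _).trans (hC s hs')))

/-- Integration by parts moves the derivative onto `φ`, so `w` may have unbounded variation, as
Brownian paths do. Each step errs by at most `C δ (t / n)`, with `δ` bounding the oscillation of `w`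
over the step. -/
theorem tendsto_sum_inner_increment {φ φ' w : ℝ → V} (hφ : ∀ s, HasDerivAt φ (φ' s) s)
    (hφ' : Continuous φ') (hw : Continuous w) {t : ℝ} (ht : 0 ≤ t) :
    Tendsto (fun n : ℕ ↦ ∑ k ∈ Finset.range n,
        inner ℝ (φ (k * (t / n))) (w ((k + 1 : ℕ) * (t / n)) - w (k * (t / n)))) atTop
      (𝓝 (inner ℝ (φ t) (w t) - inner ℝ (φ 0) (w 0) - ∫ s in 0..t, inner ℝ (φ' s) (w s))) := by
  obtain ⟨C, hC⟩ := isCompact_Icc.exists_bound_of_continuousOn (s := Set.Icc 0 t) hφ'.continuousOn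
  have hC0 : 0 ≤ C := (norm_nonneg _).trans (hC 0 ⟨le_rfl, ht⟩)
  have huc := (isCompact_Icc (a := (0 : ℝ)) (b := t)).uniformContinuousOn_of_continuous
    hw.continuousOn
  rw [Metric.tendsto_atTop]
  intro e he
  -- The total error is at most `C t δ`; the `+ 1` makes it strictly less than `e` and covers `C t =
  -- 0`.
  have hδ : 0 < e / (C * t + 1) := by positivity
  obtain ⟨η, hη, hwη⟩ := Metric.uniformContinuousOn_iff.1 huc _ hδ
  obtain ⟨N, hN⟩ := exists_nat_gt (t / η)
  refine ⟨N + 1, fun n hn ↦ ?_⟩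
  have hn0 : (0 : ℝ) < n := by exact_mod_cast (by omega : 0 < n)
  have hh0 : 0 ≤ t / n := by positivity
  have hhη : t / n < η := by
    rw [div_lt_iff₀ hn0, mul_comm, ← div_lt_iff₀ hη]
    exact hN.trans_le (by exact_mod_cast (by omega : N ≤ n))
  let G : ℕ → ℝ := fun k ↦ inner ℝ (φ (k * (t / n))) (w (k * (t / n))) -
    ∫ s in 0..k * (t / n), inner ℝ (φ' s) (w s)
  have hG : inner ℝ (φ t) (w t) - inner ℝ (φ 0) (w 0) - ∫ s in 0..t, inner ℝ (φ' s) (w s)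
      = ∑ k ∈ Finset.range n, (G (k + 1) - G k) := by
    have hn1 : (n : ℝ) * (t / n) = t := mul_div_cancel₀ t hn0.ne'
    rw [Finset.sum_range_sub]
    simp [G, hn1]
    ring
  rw [dist_eq_norm, hG, ← Finset.sum_sub_distrib]
  calc _ ≤ ∑ k ∈ Finset.range n, C * (e / (C * t + 1)) * (t / n) := by
        refine norm_sum_le_of_le _ fun k hk ↦ ?_
        have hk' : ((k + 1 : ℕ) : ℝ) * (t / n) ≤ t := by
          calc ((k + 1 : ℕ) : ℝ) * (t / n) ≤ n * (t / n) := by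
                gcongr; exact Finset.mem_range.1 hk
            _ = t := mul_div_cancel₀ t hn0.ne'
        have hstep : ((k + 1 : ℕ) : ℝ) * (t / n) - k * (t / n) = t / n := by push_cast; ring
        have hk0 : 0 ≤ (k : ℝ) * (t / n) := by positivity
        have key := norm_inner_increment_sub_le hφ hφ' hw (a := k * (t / n))
          (b := (k + 1 : ℕ) * (t / n)) (C := C) (δ := e / (C * t + 1)) (by linarith)
          (fun s hs ↦ hC s ⟨hk0.trans hs.1, hs.2.trans hk'⟩)
          (fun s hs ↦ by
            rw [← dist_eq_norm]
            refine (hwη s ⟨hk0.trans hs.1, hs.2.trans hk'⟩ _ ⟨?_, hk'⟩ ?_).le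
            · exact hk0.trans (hs.1.trans hs.2)
            · rw [Real.dist_eq, abs_sub_lt_iff]
              constructor <;> linarith [hs.1, hs.2])
        rw [hstep] at key
        refine le_of_eq_of_le (congrArg norm (congrArg _ ?_)) key
        simp only [G]
        rw [← intervalIntegral.integral_add_adjacent_intervals (a := 0) (b := k * (t / n))
          (c := (k + 1 : ℕ) * (t / n)) (Continuous.intervalIntegrable (by fun_prop) _ _)
          (Continuous.intervalIntegrable (by fun_prop) _ _)]
        ring
    _ = (C * t) / (C * t + 1) * e := by
        rw [Finset.sum_const, Finset.card_range, nsmul_eq_mul]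
        field_simp
    _ < e := by
        have : (C * t) / (C * t + 1) < 1 := by
          rw [div_lt_one (by positivity)]; linarith
        nlinarith

/-- This is the case `w = id` of the previous limit. -/
theorem tendsto_sum_deriv_mul {F ψ ψ' : ℝ → ℝ} (hF : ∀ s, HasDerivAt F (ψ s) s)
    (hψ : ∀ s, HasDerivAt ψ (ψ' s) s) (hψ' : Continuous ψ') {t : ℝ} (ht : 0 ≤ t) :
    Tendsto (fun n : ℕ ↦ ∑ k ∈ Finset.range n, ψ (k * (t / n)) * (t / n)) atTop
      (𝓝 (F t - F 0)) := by
  have h := tendsto_sum_inner_increment hψ hψ' continuous_id ht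
  have hI : ∫ s in 0..t, inner ℝ (ψ' s) (id s) = (ψ t * t - F t) - (ψ 0 * 0 - F 0) := by
    refine intervalIntegral.integral_eq_sub_of_hasDerivAt (f := fun s ↦ ψ s * s - F s)
      (fun s _ ↦ ?_) (Continuous.intervalIntegrable (by fun_prop) _ _)
    exact (((hψ s).mul (hasDerivAt_id s)).sub (hF s)).congr_deriv (by simp [mul_comm])
  rw [hI] at h
  convert h using 2
  · refine Finset.sum_congr rfl fun k _ ↦ ?_
    simp
    ring
  · simp
    ring

end RiemannStieltjes

/-! ### The semigroup and linear integral equations -/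

section Flow

variable {ι E : Type*} [Fintype ι] [NormedAddCommGroup E] [InnerProductSpace ℝ E]

/-- The semigroup `exp (-s M)`, for the operator `M` with eigenvalues `a` in the basis `b`. -/
noncomputable def expFlow (b : OrthonormalBasis ι ℝ E) (a : ι → ℝ) (s : ℝ) (x : E) : E :=
  ∑ i, (Real.exp (-(s * a i)) * inner ℝ (b i) x) • b i

variable (b : OrthonormalBasis ι ℝ E) (a : ι → ℝ)

theorem expFlow_zero (x : E) : expFlow b a 0 x = x := by
  simp [expFlow, b.sum_repr']

theorem hasDerivAt_expFlow {M : E →L[ℝ] E} (hM : ∀ i, M (b i) = a i • b i) (x : E) (s : ℝ) :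
    HasDerivAt (fun s ↦ expFlow b a s x) (-M (expFlow b a s x)) s := by
  simp only [expFlow, map_sum, map_smul, hM, ← Finset.sum_neg_distrib]
  refine HasDerivAt.fun_sum fun i _ ↦ ?_
  have h : HasDerivAt (fun s : ℝ ↦ -(s * a i)) (-(1 * a i)) s :=
    ((hasDerivAt_id s).mul_const (a i)).neg
  convert ((h.exp.mul_const (inner ℝ (b i) x)).smul_const (b i)) using 1
  rw [smul_smul, ← neg_smul]
  ring_nf

theorem tendsto_expFlow (ha : ∀ i, 0 < a i) (x : E) :
    Tendsto (fun s ↦ expFlow b a s x) atTop (𝓝 0) := by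
  have : Tendsto (fun s : ℝ ↦ ∑ i, (Real.exp (-(s * a i)) * inner ℝ (b i) x) • b i) atTop
      (𝓝 (∑ i, ((0 : ℝ) * inner ℝ (b i) x) • b i)) := by
    refine tendsto_finsetSum _ fun i _ ↦ Tendsto.smul_const (Tendsto.mul_const _ ?_) _
    exact Real.tendsto_exp_neg_atTop_nhds_zero.comp (tendsto_id.atTop_mul_const (ha i))
  simpa [expFlow] using this

theorem inner_map_left_of_eigenbasis {M : E →L[ℝ] E} (hM : ∀ i, M (b i) = a i • b i) (x y : E) :
    inner ℝ (M x) y = inner ℝ x (M y) := by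
  classical
  rw [← b.sum_repr' x, ← b.sum_repr' y]
  simp only [map_sum, map_smul, hM, sum_inner, inner_sum, real_inner_smul_left,
    real_inner_smul_right, orthonormal_iff_ite.1 b.orthonormal]
  refine Finset.sum_congr rfl fun i _ ↦ Finset.sum_congr rfl fun j _ ↦ ?_
  split_ifs with h
  · subst h; ring
  · simp

variable [CompleteSpace E]

/-- Variation of constants, in weak form. -/
theorem inner_eq_of_linear_integral_equation {M : E →L[ℝ] E} (hM : ∀ i, M (b i) = a i • b i)
    {θ g : ℝ → E} (hθ : Continuous θ) (hg : Continuous g) {t : ℝ} (ht : 0 ≤ t)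
    (h : ∀ s, 0 ≤ s → θ s = θ 0 - (∫ r in (0 : ℝ)..s, M (θ r)) + g s) (x : E) :
    inner ℝ x (θ t) = inner ℝ (expFlow b a t x) (θ 0) +
      (inner ℝ x (g t) - ∫ s in 0..t, inner ℝ (M (expFlow b a (t - s) x)) (g s)) := by
  let u : ℝ → E := fun s ↦ expFlow b a (t - s) x
  have hu (s : ℝ) : HasDerivAt u (M (u s)) s := by
    exact ((hasDerivAt_expFlow b a hM x (t - s)).scomp s
      ((hasDerivAt_id s).const_sub t)).congr_deriv (by simp [u])
  have hu_cont : Continuous u := continuous_iff_continuousAt.2 fun s ↦ (hu s).continuousAt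
  -- Unlike `θ`, the difference `ζ = θ - g` is differentiable. In the derivative of `⟪u, ζ⟫` the
  -- terms in `θ` cancel by symmetry of `M`, leaving `-⟪M u, g⟫`.
  let ζ : ℝ → E := fun s ↦ θ 0 - ∫ r in (0 : ℝ)..s, M (θ r)
  have hζ (s : ℝ) : HasDerivAt ζ (-M (θ s)) s := by
    have hc : Continuous fun r ↦ M (θ r) := by fun_prop
    exact (hc.integral_hasStrictDerivAt 0 s).hasDerivAt.const_sub _
  have hθζ (s : ℝ) (hs : 0 ≤ s) : θ s = ζ s + g s := h s hs
  have hI : ∫ s in 0..t, -inner ℝ (M (u s)) (g s) = inner ℝ (u t) (ζ t) - inner ℝ (u 0) (ζ 0) := by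
    refine intervalIntegral.integral_eq_sub_of_hasDerivAt (f := fun s ↦ inner ℝ (u s) (ζ s))
      (fun s hs ↦ ?_) (Continuous.intervalIntegrable (by fun_prop) _ _)
    rw [Set.uIcc_of_le ht] at hs
    refine ((hu s).inner ℝ (hζ s)).congr_deriv ?_
    rw [inner_neg_right, hθζ s hs.1, map_add, inner_add_right,
      ← inner_map_left_of_eigenbasis b a hM, ← inner_map_left_of_eigenbasis b a hM]
    ring
  rw [intervalIntegral.integral_neg] at hI
  have h0 : ζ 0 = θ 0 := by simp [ζ]
  have hut : u t = x := by simp [u, expFlow_zero]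
  rw [hut, h0] at hI
  rw [hθζ t ht, inner_add_right]
  simp only [u, sub_zero] at hI
  linarith

/-- The primitive `Y` of the solution satisfies `Y' + M Y = x₀ + g`, which an integrating factor
solves in each eigendirection; then `θ = Y'`. -/
theorem exists_linear_integral_equation {M : E →L[ℝ] E} (hM : ∀ i, M (b i) = a i • b i)
    (x₀ : E) {g : ℝ → E} (hg : Continuous g) (hg0 : g 0 = 0) :
    ∃ θ : ℝ → E, Continuous θ ∧ θ 0 = x₀ ∧
      ∀ s, θ s = θ 0 - (∫ r in (0 : ℝ)..s, M (θ r)) + g s := by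
  let c : ι → ℝ → ℝ := fun i s ↦ ∫ r in (0 : ℝ)..s, Real.exp (r * a i) * inner ℝ (b i) (x₀ + g r)
  let Y : ℝ → E := fun s ↦ ∑ i, (Real.exp (-(s * a i)) * c i s) • b i
  have hc (i : ι) (s : ℝ) :
      HasDerivAt (c i) (Real.exp (s * a i) * inner ℝ (b i) (x₀ + g s)) s := by
    have hcont : Continuous fun r ↦ Real.exp (r * a i) * inner ℝ (b i) (x₀ + g r) := by fun_prop
    exact (hcont.integral_hasStrictDerivAt 0 s).hasDerivAt
  have hY (s : ℝ) : HasDerivAt Y (x₀ + g s - M (Y s)) s := by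
    have h1 : x₀ + g s - M (Y s) =
        ∑ i, (inner ℝ (b i) (x₀ + g s) - a i * (Real.exp (-(s * a i)) * c i s)) • b i := by
      simp only [sub_smul, Finset.sum_sub_distrib, b.sum_repr', Y, map_sum, map_smul, hM,
        smul_smul]
      congr 1
      exact Finset.sum_congr rfl fun i _ ↦ by rw [mul_comm (a i)]
    rw [h1]
    refine HasDerivAt.fun_sum fun i _ ↦ HasDerivAt.smul_const ?_ (b i)
    have h : HasDerivAt (fun s : ℝ ↦ -(s * a i)) (-(1 * a i)) s :=
      ((hasDerivAt_id s).mul_const (a i)).neg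
    refine (h.exp.mul (hc i s)).congr_deriv ?_
    rw [← mul_assoc (Real.exp _) (Real.exp _), ← Real.exp_add, neg_add_cancel, Real.exp_zero]
    ring
  have hYc : Continuous Y := continuous_iff_continuousAt.2 fun s ↦ (hY s).continuousAt
  have hY0 : Y 0 = 0 := by simp [Y, c]
  refine ⟨fun s ↦ x₀ + g s - M (Y s), by fun_prop, by simp [hY0, hg0], fun s ↦ ?_⟩
  rw [M.intervalIntegral_comp_comm (Continuous.intervalIntegrable (by fun_prop) _ _),
    intervalIntegral.integral_eq_sub_of_hasDerivAt (fun r _ ↦ hY r)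
      (Continuous.intervalIntegrable (by fun_prop) _ _), hY0]
  simp only [hg0, hY0, map_zero, sub_zero, add_zero]
  abel

end Flow

/-! ### The Lyapunov equation -/

section Lyapunov

/-- In an eigenbasis of `A` the equation decouples into `(l i + l j) Y i j = G i j`, and the sums of
eigenvalues are positive. -/
theorem Matrix.PosDef.exists_lyapunov {d : ℕ} {A : Matrix (Fin d) (Fin d) ℝ} (hA : A.PosDef)
    {C : Matrix (Fin d) (Fin d) ℝ} (hC : Cᵀ = C) :
    ∃ X : Matrix (Fin d) (Fin d) ℝ, Xᵀ = X ∧ X * A + A * X = C := by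
  have hpos := hA.eigenvalues_pos
  have hAU := hA.isHermitian.spectral_theorem
  set l := hA.isHermitian.eigenvalues
  have hU := hA.isHermitian.eigenvectorUnitary.2
  set U : Matrix (Fin d) (Fin d) ℝ :=
    (hA.isHermitian.eigenvectorUnitary).1
  have h1 : Uᵀ * U = 1 := (Matrix.mem_unitaryGroup_iff'.1 hU)
  have h2 : U * Uᵀ = 1 := (Matrix.mem_unitaryGroup_iff.1 hU)
  have hAU' : A = U * Matrix.diagonal l * Uᵀ := by
    simpa [Unitary.conjStarAlgAut_apply, Matrix.star_eq_conjTranspose, Function.comp_def] using hAU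
  let G := Uᵀ * C * U
  have hG : Gᵀ = G := by simp [G, Matrix.transpose_mul, hC, Matrix.mul_assoc]
  let Y : Matrix (Fin d) (Fin d) ℝ := Matrix.of fun i j ↦ G i j / (l i + l j)
  have hYsymm : Yᵀ = Y := by
    ext i j
    have : G j i = G i j := congrFun (congrFun hG i) j
    simp [Y, this, add_comm]
  have hY : Y * Matrix.diagonal l + Matrix.diagonal l * Y = G := by
    ext i j
    have := hpos i
    have := hpos j
    have : l i + l j ≠ 0 := by positivity
    simp only [Matrix.add_apply, Matrix.mul_diagonal, Matrix.diagonal_mul, Y, Matrix.of_apply]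
    field_simp
    ring
  refine ⟨U * Y * Uᵀ, by simp [Matrix.transpose_mul, hYsymm, Matrix.mul_assoc], ?_⟩
  calc U * Y * Uᵀ * A + A * (U * Y * Uᵀ)
      = U * (Y * (Uᵀ * U) * Matrix.diagonal l + Matrix.diagonal l * (Uᵀ * U) * Y) * Uᵀ := by
        rw [hAU']; noncomm_ring
    _ = (U * Uᵀ) * C * (U * Uᵀ) := by
        rw [h1, Matrix.mul_one, Matrix.mul_one, hY]; simp only [G]; noncomm_ring
    _ = C := by rw [h2, Matrix.one_mul, Matrix.mul_one]

end Lyapunov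

/-! ### Characteristic functions of weighted Brownian increments -/

section BrownianIncrements

variable {Ω : Type*} [MeasurableSpace Ω] {P : Measure Ω}

/-- Increments over disjoint steps are independent with variance `h`. The argument `1` loses
nothing, since `c` can be rescaled. -/
theorem ProbabilityTheory.IsPreBrownianReal.charFun_sum_increments {X : ℝ≥0 → Ω → ℝ}
    (hX : IsPreBrownianReal X P) (c : ℕ → ℝ) (h : ℝ≥0) (n : ℕ) :
    charFun (P.map fun ω ↦ ∑ k ∈ Finset.range n, c k * (X ((k + 1 : ℕ) * h) ω - X (k * h) ω)) 1
      = Complex.exp (-(∑ k ∈ Finset.range n, c k ^ 2 * (h : ℝ)) / 2 : ℝ) := by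
  have hmono : Monotone fun k : ℕ ↦ (k : ℝ≥0) * h := fun i j hij ↦ by
    dsimp only; gcongr
  have hm (t : ℝ≥0) := hX.aemeasurable t
  have hind : iIndepFun (fun k ω ↦ c k * (X ((k + 1 : ℕ) * h) ω - X (k * h) ω)) P :=
    (hX.hasIndepIncrements.nat hmono).comp (fun k x ↦ c k * x) fun k ↦ by fun_prop
  rw [iIndepFun.charFun_map_fun_finsetSum_eq_prod
      (X := fun k ω ↦ c k * (X ((k + 1 : ℕ) * h) ω - X (k * h) ω))
      (fun k _ ↦ ((hm _).sub (hm _)).const_mul _)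
      (hind.precomp (g := ((↑) : Finset.range n → ℕ)) Subtype.val_injective),
    Finset.prod_apply]
  have hk (k : ℕ) : charFun (P.map fun ω ↦ c k * (X ((k + 1 : ℕ) * h) ω - X (k * h) ω)) 1
      = Complex.exp (-(c k ^ 2 * (h : ℝ)) / 2 : ℝ) := by
    have hlaw := hX.hasLaw_sub ((k + 1 : ℕ) * h) (k * h)
    have hd : nndist (((k + 1 : ℕ) * h : ℝ≥0) : ℝ) ((k * h : ℝ≥0) : ℝ) = h := by
      ext
      rw [coe_nndist, Real.dist_eq]
      push_cast
      rw [show ((k : ℝ) + 1) * h - k * h = h by ring]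
      exact abs_of_nonneg h.2
    have hmap : P.map (fun ω ↦ c k * (X ((k + 1 : ℕ) * h) ω - X (k * h) ω))
        = (P.map (X ((k + 1 : ℕ) * h) - X (k * h))).map (fun x ↦ c k * x) := by
      rw [AEMeasurable.map_map_of_aemeasurable (by fun_prop) hlaw.aemeasurable]
      rfl
    rw [hmap, charFun_map_mul, hlaw.map_eq, charFun_gaussianReal]
    congr 1
    erw [hd]
    push_cast
    ring
  rw [Finset.prod_congr rfl fun k _ ↦ hk k, ← Complex.exp_sum]
  congr 1
  push_cast
  rw [← Finset.sum_div, Finset.sum_neg_distrib]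

theorem IsStandardBrownianMotion.aemeasurable {m : ℕ} {W : ℝ≥0 → Ω → EuclideanSpace ℝ (Fin m)}
    (hW : IsStandardBrownianMotion P W) (t : ℝ≥0) : AEMeasurable (W t) P := by
  have : AEMeasurable (fun ω ↦ WithLp.toLp 2 (W t ω).ofLp) P :=
    (WithLp.measurable_toLp 2 (Fin m → ℝ)).comp_aemeasurable
      (aemeasurable_pi_lambda _ fun j ↦ (hW.isBrownianReal j).aemeasurable t)
  exact this

theorem IsStandardBrownianMotion.ae_continuous {m : ℕ} {W : ℝ≥0 → Ω → EuclideanSpace ℝ (Fin m)}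
    (hW : IsStandardBrownianMotion P W) : ∀ᵐ ω ∂P, Continuous (fun t ↦ W t ω) ∧ W 0 ω = 0 := by
  have h1 : ∀ᵐ ω ∂P, ∀ j, Continuous (fun t ↦ W t ω j) :=
    ae_all_iff.2 fun j ↦ (hW.isBrownianReal j).cont
  have h2 : ∀ᵐ ω ∂P, ∀ j, W 0 ω j = 0 :=
    ae_all_iff.2 fun j ↦ (hW.isBrownianReal j).eval_zero_ae_eq_zero
  filter_upwards [h1, h2] with ω h1 h2
  exact ⟨(PiLp.continuous_toLp 2 _).comp (continuous_pi h1), by ext j; simpa using h2 j⟩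

theorem IsStandardBrownianMotion.charFun_sum_inner_increments {m : ℕ}
    {W : ℝ≥0 → Ω → EuclideanSpace ℝ (Fin m)} (hW : IsStandardBrownianMotion P W)
    (φ : ℕ → EuclideanSpace ℝ (Fin m)) (h : ℝ≥0) (n : ℕ) :
    charFun (P.map fun ω ↦
        ∑ k ∈ Finset.range n, inner ℝ (φ k) (W ((k + 1 : ℕ) * h) ω - W (k * h) ω)) 1
      = Complex.exp (-(∑ k ∈ Finset.range n, ‖φ k‖ ^ 2 * (h : ℝ)) / 2 : ℝ) := by
  let R : Fin m → Ω → ℝ := fun j ω ↦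
    ∑ k ∈ Finset.range n, φ k j * (W ((k + 1 : ℕ) * h) ω j - W (k * h) ω j)
  have hR : ProbabilityTheory.iIndepFun R P :=
    hW.iIndepFun.comp (fun j (p : ℝ≥0 → ℝ) ↦
      ∑ k ∈ Finset.range n, φ k j * (p ((k + 1 : ℕ) * h) - p (k * h))) fun j ↦ by fun_prop
  have hRm (j : Fin m) : AEMeasurable (R j) P := by
    have (t : ℝ≥0) := (hW.isBrownianReal j).aemeasurable t
    exact Finset.aemeasurable_fun_sum _ fun k _ ↦ ((this _).sub (this _)).const_mul _
  have hsum : (fun ω ↦ ∑ k ∈ Finset.range n,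
      inner ℝ (φ k) (W ((k + 1 : ℕ) * h) ω - W (k * h) ω)) = fun ω ↦ ∑ j, R j ω := by
    ext ω
    simp only [R, PiLp.inner_apply]
    rw [Finset.sum_comm]
    simp [mul_comm]
  rw [hsum, hR.charFun_map_fun_sum_eq_prod hRm, Finset.prod_apply,
    Finset.prod_congr rfl fun j _ ↦
      (hW.isBrownianReal j).charFun_sum_increments (fun k ↦ φ k j) h n,
    ← Complex.exp_sum, ← Complex.ofReal_sum, ← Finset.sum_div, Finset.sum_neg_distrib,
    Finset.sum_comm]
  simp [EuclideanSpace.norm_sq_eq, Finset.sum_mul]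

end BrownianIncrements

/-! ### The transition law -/

section OrnsteinUhlenbeck

variable {ι : Type*} [Fintype ι] {m : ℕ} {Ω : Type*} [MeasurableSpace Ω] {P : Measure Ω}
  {E : Type*} [NormedAddCommGroup E] [InnerProductSpace ℝ E] [CompleteSpace E]
  (b : OrthonormalBasis ι ℝ E) (a : ι → ℝ)
  {M : E →L[ℝ] E} (N : EuclideanSpace ℝ (Fin m) →L[ℝ] E)

/-- The Riemann sum for the Wiener integral of `exp (-(t - s) M) N` tested against `x`. -/
noncomputable def wienerSum (W : ℝ≥0 → Ω → EuclideanSpace ℝ (Fin m)) (t : ℝ≥0) (x : E)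
    (n : ℕ) : Ω → ℝ := fun ω ↦
  ∑ k ∈ Finset.range n,
    inner ℝ (N.adjoint (expFlow b a (t - (k : ℝ) * ((t : ℝ) / n)) x))
      (W ((k + 1 : ℕ) * (t / n)) ω - W (k * (t / n)) ω)

variable {W : ℝ≥0 → Ω → EuclideanSpace ℝ (Fin m)} {θ : ℝ≥0 → Ω → E}

theorem hasDerivAt_adjoint_expFlow (hM : ∀ i, M (b i) = a i • b i) (t : ℝ) (x : E) (s : ℝ) :
    HasDerivAt (fun s ↦ N.adjoint (expFlow b a (t - s) x))
      (N.adjoint (M (expFlow b a (t - s) x))) s := by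
  have h : HasDerivAt (fun s ↦ expFlow b a (t - s) x) (M (expFlow b a (t - s) x)) s :=
    ((hasDerivAt_expFlow b a hM x (t - s)).scomp s
      ((hasDerivAt_id s).const_sub t)).congr_deriv (by simp)
  exact (N.adjoint.hasFDerivAt.comp_hasDerivAt s h)

omit [CompleteSpace E] in
theorem continuous_expFlow_sub (hM : ∀ i, M (b i) = a i • b i) (t : ℝ) (x : E) :
    Continuous fun s ↦ expFlow b a (t - s) x := by
  have : Continuous fun s ↦ expFlow b a s x :=
    continuous_iff_continuousAt.2 fun s ↦ (hasDerivAt_expFlow b a hM x s).continuousAt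
  exact this.comp (continuous_sub_left t)

omit [MeasurableSpace Ω] in
theorem tendsto_inner_add_wienerSum (hM : ∀ i, M (b i) = a i • b i) {ω : Ω}
    (hW : Continuous fun t ↦ W t ω) (hW0 : W 0 ω = 0) (hθ : Continuous fun t ↦ θ t ω)
    (h : ∀ t : ℝ≥0, θ t ω = θ 0 ω - (∫ s in (0 : ℝ)..t, M (θ s.toNNReal ω)) + N (W t ω))
    (t : ℝ≥0) (x : E) :
    Tendsto (fun n ↦ inner ℝ (expFlow b a t x) (θ 0 ω) + wienerSum b a N W t x n ω) atTop
      (𝓝 (inner ℝ x (θ t ω))) := by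
  have hWc : Continuous fun s : ℝ ↦ W s.toNNReal ω := hW.comp continuous_real_toNNReal
  have hθc : Continuous fun s : ℝ ↦ θ s.toNNReal ω := hθ.comp continuous_real_toNNReal
  have hu := continuous_expFlow_sub b a hM t x
  have key := inner_eq_of_linear_integral_equation b a hM (θ := fun s ↦ θ s.toNNReal ω)
    (g := fun s ↦ N (W s.toNNReal ω)) hθc (by fun_prop) t.2 (fun s hs ↦ by
      have := h s.toNNReal
      rw [Real.coe_toNNReal s hs] at this
      simpa using this) x
  have lim := tendsto_sum_inner_increment (hasDerivAt_adjoint_expFlow b a N hM t x)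
    (by fun_prop) hWc t.2
  simp only [NNReal.val_eq_coe, Real.toNNReal_coe, Real.toNNReal_zero, hW0, inner_zero_right,
    sub_self, expFlow_zero, sub_zero, ContinuousLinearMap.adjoint_inner_left] at key lim
  rw [key]
  refine Tendsto.const_add _ (lim.congr fun n ↦ Finset.sum_congr rfl fun k _ ↦ ?_)
  have hk (j : ℕ) : ((j : ℝ) * ((t : ℝ) / n)).toNNReal = j * (t / n) := by
    rw [← Real.toNNReal_coe (r := j * (t / n))]
    push_cast
    rfl
  rw [hk, hk, ContinuousLinearMap.adjoint_inner_left]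

theorem IsStandardBrownianMotion.charFun_wienerSum (hW : IsStandardBrownianMotion P W)
    (t : ℝ≥0) (x : E) (n : ℕ) :
    charFun (P.map (wienerSum b a N W t x n)) 1 = Complex.exp (-(∑ k ∈ Finset.range n,
      ‖N.adjoint (expFlow b a (t - (k : ℝ) * ((t : ℝ) / n)) x)‖ ^ 2 * ((t : ℝ) / n)) / 2 : ℝ) := by
  have := hW.charFun_sum_inner_increments
    (fun k ↦ N.adjoint (expFlow b a (t - (k : ℝ) * ((t : ℝ) / n)) x)) (t / n) n
  unfold wienerSum
  simpa using this

theorem IsStandardBrownianMotion.aemeasurable_wienerSum (hW : IsStandardBrownianMotion P W)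
    (t : ℝ≥0) (x : E) (n : ℕ) : AEMeasurable (wienerSum b a N W t x n) P :=
  Finset.aemeasurable_fun_sum _ fun _ _ ↦
    ((hW.aemeasurable _).sub (hW.aemeasurable _)).const_inner

/-- If the operator `T` solves the Lyapunov equation, then `⟪x, T x⟫ - ⟪e(t) x, T e(t) x⟫` is
the variance of the Wiener integral of `exp (-(t - s) M) N` tested against `x`. -/
theorem tendsto_variance_wienerSum (hM : ∀ i, M (b i) = a i • b i) {T : E →L[ℝ] E}
    (hT : ∀ y, inner ℝ (M y) (T y) + inner ℝ y (T (M y)) = ‖N.adjoint y‖ ^ 2)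
    (t : ℝ≥0) (x : E) :
    Tendsto (fun n : ℕ ↦ ∑ k ∈ Finset.range n,
        ‖N.adjoint (expFlow b a (t - (k : ℝ) * ((t : ℝ) / n)) x)‖ ^ 2 * ((t : ℝ) / n)) atTop
      (𝓝 (inner ℝ x (T x) - inner ℝ (expFlow b a t x) (T (expFlow b a t x)))) := by
  have hu (s : ℝ) : HasDerivAt (fun s ↦ expFlow b a (t - s) x) (M (expFlow b a (t - s) x)) s :=
    ((hasDerivAt_expFlow b a hM x (t - s)).scomp s
      ((hasDerivAt_id s).const_sub (t : ℝ))).congr_deriv (by simp)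
  have huc := continuous_expFlow_sub b a hM t x
  have hF (s : ℝ) : HasDerivAt
      (fun s ↦ inner ℝ (expFlow b a (t - s) x) (T (expFlow b a (t - s) x)))
      (‖N.adjoint (expFlow b a (t - s) x)‖ ^ 2) s := by
    refine ((hu s).inner ℝ (T.hasFDerivAt.comp_hasDerivAt s (hu s))).congr_deriv ?_
    rw [← hT]
    simp [add_comm]
  have hψ (s : ℝ) := (hasDerivAt_adjoint_expFlow b a N hM t x s).norm_sq
  simpa [expFlow_zero] using tendsto_sum_deriv_mul hF hψ (by fun_prop) t.2

variable [MeasurableSpace E] [BorelSpace E] [SecondCountableTopology E] [IsProbabilityMeasure P]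

/-- The transition law of the Ornstein--Uhlenbeck process, in terms of characteristic functions. -/
theorem charFun_ornsteinUhlenbeck (hM : ∀ i, M (b i) = a i • b i) {T : E →L[ℝ] E}
    (hT : ∀ y, inner ℝ (M y) (T y) + inner ℝ y (T (M y)) = ‖N.adjoint y‖ ^ 2)
    (hW : IsStandardBrownianMotion P W) (hm : ∀ t, AEMeasurable (θ t) P)
    (hind : IndepFun (θ 0) (fun ω (t : ℝ≥0) ↦ W t ω) P)
    (hθ : ∀ᵐ ω ∂P, Continuous fun t ↦ θ t ω)
    (h : ∀ᵐ ω ∂P, ∀ t : ℝ≥0,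
      θ t ω = θ 0 ω - (∫ s in (0 : ℝ)..t, M (θ s.toNNReal ω)) + N (W t ω))
    (t : ℝ≥0) (x : E) :
    charFun (P.map (θ t)) x = charFun (P.map (θ 0)) (expFlow b a t x) *
      Complex.exp (-(inner ℝ x (T x) -
        inner ℝ (expFlow b a t x) (T (expFlow b a t x))) / 2 : ℝ) := by
  have hRm := hW.aemeasurable_wienerSum b a N t x
  have h0m : AEMeasurable (fun ω ↦ inner ℝ (expFlow b a t x) (θ 0 ω)) P := (hm 0).const_inner
  have hinner (s : ℝ≥0) (y : E) :
      charFun (P.map (θ s)) y = ∫ ω, Complex.exp (inner ℝ y (θ s ω) * Complex.I) ∂P := by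
    rw [charFun_apply, integral_map (hm s) (by fun_prop)]
    simp_rw [real_inner_comm]
  have hone {R : Ω → ℝ} (hR : AEMeasurable R P) :
      charFun (P.map R) 1 = ∫ ω, Complex.exp (R ω * Complex.I) ∂P := by
    rw [charFun_apply, integral_map hR (by fun_prop)]
    simp
  have hindR (n : ℕ) : IndepFun (fun ω ↦ inner ℝ (expFlow b a t x) (θ 0 ω))
      (wienerSum b a N W t x n) P := by
    refine hind.comp (φ := fun y ↦ inner ℝ (expFlow b a t x) y)
      (ψ := fun p : ℝ≥0 → EuclideanSpace ℝ (Fin m) ↦ ∑ k ∈ Finset.range n,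
        inner ℝ (N.adjoint (expFlow b a (t - (k : ℝ) * ((t : ℝ) / n)) x))
          (p ((k + 1 : ℕ) * (t / n)) - p (k * (t / n)))) (by fun_prop) ?_
    refine Finset.measurable_fun_sum _ fun k _ ↦ Measurable.const_inner ?_
    have hp (s : ℝ≥0) : Measurable fun p : ℝ≥0 → EuclideanSpace ℝ (Fin m) ↦ p s :=
      measurable_pi_apply s
    exact (hp _).sub (hp _)
  have hprod (n : ℕ) : ∫ ω, Complex.exp
      (((inner ℝ (expFlow b a t x) (θ 0 ω) + wienerSum b a N W t x n ω : ℝ) : ℂ) * Complex.I) ∂P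
      = charFun (P.map (θ 0)) (expFlow b a t x) * Complex.exp (-(∑ k ∈ Finset.range n,
        ‖N.adjoint (expFlow b a (t - (k : ℝ) * ((t : ℝ) / n)) x)‖ ^ 2 * ((t : ℝ) / n)) / 2 : ℝ) := by
    refine (hone (h0m.add (hRm n))).symm.trans ?_
    rw [(hindR n).charFun_map_add_eq_mul h0m (hRm n), Pi.mul_apply,
      hW.charFun_wienerSum, hinner, hone h0m]
  have lim1 : Tendsto (fun n ↦ ∫ ω, Complex.exp
      (((inner ℝ (expFlow b a t x) (θ 0 ω) + wienerSum b a N W t x n ω : ℝ) : ℂ) * Complex.I) ∂P)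
      atTop (𝓝 (charFun (P.map (θ t)) x)) := by
    rw [hinner]
    refine tendsto_integral_of_dominated_convergence (fun _ ↦ 1) (fun n ↦ ?_)
      (integrable_const _) (fun n ↦ ?_) ?_
    · exact (Complex.measurable_exp.comp_aemeasurable
        ((Complex.measurable_ofReal.comp_aemeasurable (h0m.add (hRm n))).mul_const
          _)).aestronglyMeasurable
    · exact ae_of_all _ fun ω ↦ (Complex.norm_exp_ofReal_mul_I _).le
    · filter_upwards [hW.ae_continuous, hθ, h] with ω hω hθω hhω
      have := tendsto_inner_add_wienerSum b a N hM hω.1 hω.2 hθω hhω t x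
      exact ((by fun_prop : Continuous fun r : ℝ ↦ Complex.exp (r * Complex.I)).tendsto _).comp this
  refine tendsto_nhds_unique lim1 ?_
  simp_rw [hprod]
  have := tendsto_variance_wienerSum b a N hM hT t x
  exact Tendsto.const_mul _ (((by fun_prop :
    Continuous fun r : ℝ ↦ Complex.exp ((-r / 2 : ℝ) : ℂ)).tendsto _).comp this)

end OrnsteinUhlenbeck

/-! ### Matrix coefficients, existence of solutions, positivity of the covariance -/

section MatrixCoefficients

variable {d m : ℕ} (A : Matrix (Fin d) (Fin d) ℝ) (B : Matrix (Fin d) (Fin m) ℝ) (ε S : ℝ)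

/-- The drift operator `ε A`. -/
noncomputable def ouDrift : EuclideanSpace ℝ (Fin d) →L[ℝ] EuclideanSpace ℝ (Fin d) :=
  ε • Matrix.toEuclideanCLM (𝕜 := ℝ) A

/-- The diffusion operator `(ε / √S) B`. -/
noncomputable def ouDiffusion : EuclideanSpace ℝ (Fin m) →L[ℝ] EuclideanSpace ℝ (Fin d) :=
  (ε / √S) • (Matrix.toLpLin 2 2 B).toContinuousLinearMap

theorem ouDrift_apply (x : EuclideanSpace ℝ (Fin d)) :
    ouDrift A ε x = ε • WithLp.toLp 2 (A *ᵥ x.ofLp) := by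
  ext i
  simp [ouDrift]

theorem ouDiffusion_apply (x : EuclideanSpace ℝ (Fin m)) :
    ouDiffusion B ε S x = (ε / √S) • WithLp.toLp 2 (B *ᵥ x.ofLp) := by
  ext i
  simp [ouDiffusion]

theorem adjoint_ouDiffusion_apply (y : EuclideanSpace ℝ (Fin d)) :
    (ouDiffusion B ε S).adjoint y = (ε / √S) • WithLp.toLp 2 (Bᵀ *ᵥ y.ofLp) := by
  refine ext_inner_right ℝ fun v ↦ ?_
  rw [ContinuousLinearMap.adjoint_inner_left, ouDiffusion_apply, inner_smul_right,
    real_inner_smul_left, EuclideanSpace.inner_eq_star_dotProduct,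
    EuclideanSpace.inner_eq_star_dotProduct]
  simp only [star_trivial]
  rw [Matrix.mulVec_transpose, dotProduct_comm v.ofLp, ← Matrix.dotProduct_mulVec, dotProduct_comm]

variable {A B ε S}

theorem lyapunov_inner (hA : Aᵀ = A) (hS : 0 < S) {X : Matrix (Fin d) (Fin d) ℝ}
    (hX : X * A + A * X = (ε / S) • (B * Bᵀ)) (y : EuclideanSpace ℝ (Fin d)) :
    inner ℝ (ouDrift A ε y) (Matrix.toEuclideanCLM (𝕜 := ℝ) X y) +
      inner ℝ y (Matrix.toEuclideanCLM (𝕜 := ℝ) X (ouDrift A ε y)) =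
        ‖(ouDiffusion B ε S).adjoint y‖ ^ 2 := by
  have h : y.ofLp ⬝ᵥ ((X * A + A * X) *ᵥ y.ofLp) = y.ofLp ⬝ᵥ (((ε / S) • (B * Bᵀ)) *ᵥ y.ofLp) := by
    rw [hX]
  rw [Matrix.add_mulVec, dotProduct_add, Matrix.smul_mulVec, dotProduct_smul,
    ← Matrix.mulVec_mulVec, ← Matrix.mulVec_mulVec, ← Matrix.mulVec_mulVec,
    Matrix.dotProduct_mulVec _ A, Matrix.dotProduct_mulVec _ B, ← Matrix.mulVec_transpose,
    ← Matrix.mulVec_transpose, hA] at h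
  rw [← real_inner_self_eq_norm_sq, adjoint_ouDiffusion_apply, ouDrift_apply,
    Matrix.inner_toEuclideanCLM, Matrix.inner_toEuclideanCLM, real_inner_smul_left,
    real_inner_smul_right, EuclideanSpace.inner_eq_star_dotProduct]
  simp only [WithLp.ofLp_smul, star_trivial, Matrix.mulVec_smul, smul_dotProduct, dotProduct_smul,
    smul_eq_mul] at h ⊢
  have hsq : (ε / √S) * (ε / √S) = ε * (ε / S) := by
    rw [div_mul_div_comm, Real.mul_self_sqrt hS.le]
    ring
  linear_combination ε * h - (Bᵀ *ᵥ y.ofLp) ⬝ᵥ (Bᵀ *ᵥ y.ofLp) * hsq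

theorem exists_eigenbasis_ouDrift (hA : A.PosDef) (hε : 0 < ε) :
    ∃ (b : OrthonormalBasis (Fin d) ℝ (EuclideanSpace ℝ (Fin d))) (a : Fin d → ℝ),
      (∀ i, 0 < a i) ∧ ∀ i, ouDrift A ε (b i) = a i • b i := by
  refine ⟨hA.isHermitian.eigenvectorBasis, fun i ↦ ε * hA.isHermitian.eigenvalues i,
    fun i ↦ mul_pos hε (hA.eigenvalues_pos i), fun i ↦ ?_⟩
  rw [ouDrift_apply, hA.isHermitian.mulVec_eigenvectorBasis, mul_smul]
  rfl

theorem IsOUProcess.ae_equation {Ω : Type*} [MeasurableSpace Ω] {P : Measure Ω}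
    {W : ℝ≥0 → Ω → EuclideanSpace ℝ (Fin m)} {θ : ℝ≥0 → Ω → EuclideanSpace ℝ (Fin d)}
    (h : IsOUProcess A B ε S P W θ) : ∀ᵐ ω ∂P, ∀ t : ℝ≥0,
      θ t ω = θ 0 ω - (∫ s in (0 : ℝ)..t, ouDrift A ε (θ s.toNNReal ω))
        + ouDiffusion B ε S (W t ω) := by
  simpa only [ouDrift_apply, ouDiffusion_apply] using h.equation

theorem tendsto_inner_expFlow {ι E : Type*} [Fintype ι] [NormedAddCommGroup E]
    [InnerProductSpace ℝ E] (b : OrthonormalBasis ι ℝ E) (a : ι → ℝ) (ha : ∀ i, 0 < a i)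
    (T : E →L[ℝ] E) (x : E) :
    Tendsto (fun t : ℝ≥0 ↦ inner ℝ (expFlow b a t x) (T (expFlow b a t x))) atTop (𝓝 0) := by
  have h : Tendsto (fun t : ℝ≥0 ↦ expFlow b a t x) atTop (𝓝 0) :=
    (tendsto_expFlow b a ha x).comp (NNReal.tendsto_coe_atTop.2 tendsto_id)
  simpa using h.inner (𝕜 := ℝ) ((T.continuous.tendsto 0).comp h)

theorem exists_isOUProcess (hA : A.PosDef) (hε : 0 < ε) {Ω : Type*} [MeasurableSpace Ω]
    {P : Measure Ω} {W : ℝ≥0 → Ω → EuclideanSpace ℝ (Fin m)} {θ₀ : Ω → EuclideanSpace ℝ (Fin d)}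
    (hW : IsStandardBrownianMotion P W) (hθ₀ : AEMeasurable θ₀ P)
    (hind : IndepFun θ₀ (fun ω (t : ℝ≥0) ↦ W t ω) P) :
    ∃ θ, IsOUProcess A B ε S P W θ ∧ θ 0 = θ₀ := by
  obtain ⟨b, a, -, hM⟩ := exists_eigenbasis_ouDrift hA hε
  have hpath (ω : Ω) : ∃ p : ℝ≥0 → EuclideanSpace ℝ (Fin d), p 0 = θ₀ ω ∧
      ((Continuous (fun t ↦ W t ω) ∧ W 0 ω = 0) → Continuous p ∧ ∀ t : ℝ≥0,
        p t = p 0 - (∫ s in (0 : ℝ)..t, ouDrift A ε (p s.toNNReal))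
          + ouDiffusion B ε S (W t ω)) := by
    by_cases hω : Continuous (fun t ↦ W t ω) ∧ W 0 ω = 0
    · have hWc : Continuous fun s : ℝ ↦ W s.toNNReal ω := hω.1.comp continuous_real_toNNReal
      obtain ⟨p, hp, hp0, h⟩ := exists_linear_integral_equation b a hM (θ₀ ω)
        (g := fun s : ℝ ↦ ouDiffusion B ε S (W s.toNNReal ω))
        ((ouDiffusion B ε S).continuous.comp hWc) (by simp [hω.2])
      refine ⟨fun t ↦ p t, by simpa using hp0, fun _ ↦ ⟨by fun_prop, fun t ↦ ?_⟩⟩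
      have hI : ∫ s in (0 : ℝ)..t, ouDrift A ε (p s.toNNReal) =
          ∫ s in (0 : ℝ)..t, ouDrift A ε (p s) := by
        refine intervalIntegral.integral_congr fun s hs ↦ ?_
        rw [Set.uIcc_of_le (NNReal.coe_nonneg t)] at hs
        simp only [Real.coe_toNNReal s hs.1]
      simp only [hI]
      simpa using h t
    -- On the exceptional null set any path starting at `θ₀ ω` will do; this keeps `θ 0 = θ₀` true
    -- everywhere.
    · exact ⟨fun _ ↦ θ₀ ω, rfl, fun h ↦ absurd h hω⟩
  choose p hp0 hp using hpath
  have hcont : ∀ᵐ ω ∂P, Continuous (p ω) := by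
    filter_upwards [hW.ae_continuous] with ω hω using (hp ω hω).1
  have heq : ∀ᵐ ω ∂P, ∀ t : ℝ≥0, p ω t = p ω 0 -
      (∫ s in (0 : ℝ)..t, ouDrift A ε (p ω s.toNNReal)) + ouDiffusion B ε S (W t ω) := by
    filter_upwards [hW.ae_continuous] with ω hω using (hp ω hω).2
  have h0 : (fun ω ↦ p ω 0) = θ₀ := funext hp0
  -- Paths chosen separately for each `ω` carry no measurability; it comes from the almost sure
  -- limit of measurable sums.
  have hcoord (t : ℝ≥0) (x : EuclideanSpace ℝ (Fin d)) :
      AEMeasurable (fun ω ↦ inner ℝ x (p ω t)) P := by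
    refine aemeasurable_of_tendsto_metrizable_ae atTop (f := fun n ω ↦
      inner ℝ (expFlow b a t x) (p ω 0) + wienerSum b a (ouDiffusion B ε S) W t x n ω)
      (fun n ↦ ?_) ?_
    · refine AEMeasurable.add ?_ (hW.aemeasurable_wienerSum b a _ t x n)
      simp only [hp0]
      exact hθ₀.const_inner
    · filter_upwards [hW.ae_continuous, hcont, heq] with ω hω hc he
      exact tendsto_inner_add_wienerSum (θ := fun t ω ↦ p ω t) b a _ hM hω.1 hω.2 hc he t x
  refine ⟨fun t ω ↦ p ω t, ⟨hW, fun t ↦ ?_, ?_, hcont, ?_⟩, h0⟩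
  · have : AEMeasurable (fun ω ↦ WithLp.toLp 2 fun i ↦
        inner ℝ (EuclideanSpace.basisFun (Fin d) ℝ i) (p ω t)) P :=
      (WithLp.measurable_toLp 2 (Fin d → ℝ)).comp_aemeasurable
        (aemeasurable_pi_lambda _ fun i ↦ hcoord t _)
    convert this using 2 with ω
    ext i
    simp [PiLp.inner_apply]
  · rwa [h0]
  · simpa only [ouDrift_apply, ouDiffusion_apply] using heq

/-- Nonnegative variances give `⟪x, X x⟫ ≥ ⟪e(t) x, X e(t) x⟫`, and the right side tends to `0`.
This makes `X` an admissible covariance. -/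
theorem posSemidef_of_lyapunov (hA : A.PosDef) (hε : 0 < ε) (hS : 0 < S)
    {X : Matrix (Fin d) (Fin d) ℝ} (hXs : Xᵀ = X)
    (hX : X * A + A * X = (ε / S) • (B * Bᵀ)) : X.PosSemidef := by
  obtain ⟨b, a, ha, hM⟩ := exists_eigenbasis_ouDrift hA hε
  refine Matrix.PosSemidef.of_dotProduct_mulVec_nonneg hXs fun x ↦ ?_
  have hlim := tendsto_inner_expFlow b a ha (Matrix.toEuclideanCLM (𝕜 := ℝ) X) (WithLp.toLp 2 x)
  have := le_of_tendsto' hlim fun t ↦ sub_nonneg.1 <| ge_of_tendsto'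
    (tendsto_variance_wienerSum b a (ouDiffusion B ε S) hM
      (lyapunov_inner hA.isHermitian hS hX) t (WithLp.toLp 2 x)) fun n ↦ by positivity
  simpa only [star_trivial, Matrix.inner_toEuclideanCLM] using this

end MatrixCoefficients

/-! ### Existence, stationarity and uniqueness -/

theorem mainTheorem7 {d m : ℕ} (A : Matrix (Fin d) (Fin d) ℝ) (B : Matrix (Fin d) (Fin m) ℝ)
    (ε S : ℝ) (hA : A.PosDef) (hε : 0 < ε) (hS : 0 < S) :
    -- solutions exist for every driving Brownian motion and every independent initial value
    (∀ (Ω : Type*) [MeasurableSpace Ω] (P : Measure Ω) [IsProbabilityMeasure P]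
      (W : ℝ≥0 → Ω → EuclideanSpace ℝ (Fin m)) (θ₀ : Ω → EuclideanSpace ℝ (Fin d)),
      IsStandardBrownianMotion P W → AEMeasurable θ₀ P →
      IndepFun θ₀ (fun ω (t : ℝ≥0) ↦ W t ω) P →
      ∃ θ, IsOUProcess A B ε S P W θ ∧ θ 0 = θ₀) ∧
    ∃ q : Measure (EuclideanSpace ℝ (Fin d)),
      -- `q` is stationary: a solution started in `q` has law `q` at all times
      (∀ (Ω : Type*) [MeasurableSpace Ω] (P : Measure Ω) [IsProbabilityMeasure P]
        (W : ℝ≥0 → Ω → EuclideanSpace ℝ (Fin m)) (θ : ℝ≥0 → Ω → EuclideanSpace ℝ (Fin d)),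
        IsOUProcess A B ε S P W θ → HasLaw (θ 0) q P → ∀ t, HasLaw (θ t) q P) ∧
      -- `q` is the only stationary distribution
      (∀ (Ω : Type*) [MeasurableSpace Ω] (P : Measure Ω) [IsProbabilityMeasure P]
        (W : ℝ≥0 → Ω → EuclideanSpace ℝ (Fin m)) (θ : ℝ≥0 → Ω → EuclideanSpace ℝ (Fin d))
        (ν : Measure (EuclideanSpace ℝ (Fin d))),
        IsOUProcess A B ε S P W θ → (∀ t, HasLaw (θ t) ν P) → ν = q) ∧
      -- `q` is a centred Gaussian, and its covariance solves the Lyapunov equation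
      IsGaussian q ∧ (∫ x, x ∂q) = 0 ∧
      covarianceMatrix q * A + A * covarianceMatrix q = (ε / S) • (B * Bᵀ) := by
  obtain ⟨X, hXs, hX⟩ := hA.exists_lyapunov (C := (ε / S) • (B * Bᵀ))
    (by simp [Matrix.transpose_mul])
  have hXp := posSemidef_of_lyapunov hA hε hS hXs hX
  obtain ⟨b, a, ha, hM⟩ := exists_eigenbasis_ouDrift hA hε
  let T := Matrix.toEuclideanCLM (𝕜 := ℝ) X
  have hq (x : EuclideanSpace ℝ (Fin d)) : charFun (multivariateGaussian 0 X) x =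
      Complex.exp (-(inner ℝ x (T x)) / 2 : ℝ) := by
    rw [charFun_multivariateGaussian hXp, ← Matrix.inner_toEuclideanCLM]
    simp [T, neg_div]
  refine ⟨fun Ω _ P _ W θ₀ hW hθ₀ hind ↦ exists_isOUProcess hA hε hW hθ₀ hind,
    multivariateGaussian 0 X, fun Ω _ P _ W θ hθ h0 t ↦ ⟨hθ.aemeasurable t, ?_⟩,
    fun Ω _ P _ W θ ν hθ hν ↦ ?_, inferInstance, integral_id_multivariateGaussian, ?_⟩
  · have := Measure.isProbabilityMeasure_map (hθ.aemeasurable t)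
    refine Measure.ext_of_charFun (funext fun x ↦ ?_)
    rw [charFun_ornsteinUhlenbeck b a (ouDiffusion B ε S) hM
      (lyapunov_inner hA.isHermitian hS hX) hθ.brownian hθ.aemeasurable hθ.indep_initial
      hθ.continuous_paths hθ.ae_equation t x, h0.map_eq, hq, hq, ← Complex.exp_add]
    congr 1
    push_cast
    ring
  · have : IsProbabilityMeasure ν := (hν 0).isProbabilityMeasure_iff.1 inferInstance
    refine Measure.ext_of_charFun (funext fun x ↦ ?_)
    have h (t : ℝ≥0) : charFun ν x = charFun ν (expFlow b a t x) *
        Complex.exp (-(inner ℝ x (T x) -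
          inner ℝ (expFlow b a t x) (T (expFlow b a t x))) / 2 : ℝ) := by
      have := charFun_ornsteinUhlenbeck b a (ouDiffusion B ε S) hM
        (lyapunov_inner hA.isHermitian hS hX) hθ.brownian hθ.aemeasurable hθ.indep_initial
        hθ.continuous_paths hθ.ae_equation t x
      rwa [(hν t).map_eq, (hν 0).map_eq] at this
    have hflow : Tendsto (fun t : ℝ≥0 ↦ expFlow b a t x) atTop (𝓝 0) :=
      (tendsto_expFlow b a ha x).comp (NNReal.tendsto_coe_atTop.2 tendsto_id)
    -- As `t → ∞` the initial law contributes only `charFun ν 0 = 1`, so `charFun ν x` is the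
    -- Gaussian factor.
    have hν_lim := (continuous_charFun (μ := ν)).tendsto 0 |>.comp hflow
    have hlim := hν_lim.mul (((by fun_prop : Continuous fun r : ℝ ↦
      Complex.exp ((-(inner ℝ x (T x) - r) / 2 : ℝ) : ℂ)).tendsto _).comp
        (tendsto_inner_expFlow b a ha T x))
    rw [hq]
    refine tendsto_nhds_unique (tendsto_const_nhds (x := charFun ν x) (f := (atTop : Filter ℝ≥0))) ?_
    refine (hlim.congr fun t ↦ (h t).symm).trans_eq ?_
    simp
  · have hcov : covarianceMatrix (multivariateGaussian 0 X) = X := by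
      ext i j
      exact covariance_eval_multivariateGaussian hXp i j
    rw [hcov, hX]
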